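/- Let $p$ be a prime, let $G$ be a finite $p$-group and let $A\le\operatorname{Aut}(G)$ be a group of automorphisms of $G$. In the semidirect product of $G$ and $A$ write $[x,y]=x^{-1}y^{-1}xy$, and define left normed commutators by $[x_1]=x_1$ and $[x_1,\dots,x_m]=[[x_1,\dots,x_{m-1}],x_m]$. Let $[G,A]$ be the subgroup of $G$ generated by all $[g,a]$ with $g\in G$, $a\in A$. For $k\ge 1$ let $\gamma_k(G,A)$ be the subgroup of $G$ generated by all left normed commutators $[x_1,\dots,x_m]$, $m\ge k$, with all $x_i\in G\cup A$, with $x_1\in G$, and with at least $k-1$ of the $x_i$ lying in $A$. Suppose that $A$ acts $p$-centrally on $\gamma_p(G,A)$, that is, $A$ fixes every element of $\gamma_p(G,A)$ whose order divides $p$ (divides $4$ if $p=2$). Then: (i) for every positive integer $i$, the elements of $[G,A]$ of order dividing $p^i$ form a subgroup; (ii) for every positive integer $i$, the elements of $A$ of order dividing $p^i$ form a subgroup; (iii) $\exp([G,A])=\exp(A)$; (iv) $\exp(A)=p^n$ for some integer $n\ge 0$, and both $A$ and $[G,A]$ are nilpotent of class at most $n+p-2$. -/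

import Mathlib

/-- Let the group `A` act on the group `G` by automorphisms. Inside the semidirect product of `G`
and `A`, consider the left normed commutators `[x₁, x₂, …, xₙ] = [[x₁, …, xₙ₋₁], xₙ]` with
`x₁ ∈ G` and every other `xᵢ` in `G` or in `A`, where `[x, y] = x⁻¹ * x ^ y`. They all lie in `G`.
`IsLeftNormedCommutator A j c` says that `c` is such a commutator with exactly `j` entries
taken from `A`. -/
inductive IsLeftNormedCommutator {G : Type*} [Group G] (A : Type*) [Group A]
    [MulDistribMulAction A G] : ℕ → G → Prop
  | base (g : G) : IsLeftNormedCommutator A 0 g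
  | commGroup {j : ℕ} {c : G} (h : IsLeftNormedCommutator A j c) (g : G) :
      IsLeftNormedCommutator A j (c⁻¹ * (g⁻¹ * c * g))
  | commAction {j : ℕ} {c : G} (h : IsLeftNormedCommutator A j c) (a : A) :
      IsLeftNormedCommutator A (j + 1) (c⁻¹ * (a • c))

/-- `γ_k(G, A)` for `k ≥ 1`: the subgroup of `G` generated by all the left normed commutators with
first entry in `G`, all entries in `G ∪ A`, and at least `k - 1` entries in `A`
(such a commutator automatically has length at least `k`). -/
def gammaAction (k : ℕ) (G : Type*) [Group G] (A : Type*) [Group A]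
    [MulDistribMulAction A G] : Subgroup G :=
  Subgroup.closure {c : G | ∃ j : ℕ, k ≤ j + 1 ∧ IsLeftNormedCommutator A j c}

/-- `[G, A]`: the subgroup of `G` generated by all the `[g, a] = g⁻¹ * g ^ a`. -/
def commutatorAction (G : Type*) [Group G] (A : Type*) [Group A]
    [MulDistribMulAction A G] : Subgroup G :=
  Subgroup.closure {c : G | ∃ (g : G) (a : A), c = g⁻¹ * (a • g)}

/-- `A` acts `p`-centrally on the subgroup `H` of `G`: it fixes every element of `H` whose order
divides `p` (divides `4` if `p = 2`). -/
def ActsPCentrallyOn (p : ℕ) {G : Type*} [Group G] (A : Type*) [Group A]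
    [MulDistribMulAction A G] (H : Subgroup G) : Prop :=
  ∀ x ∈ H, orderOf x ∣ (if p = 2 then 4 else p) → ∀ a : A, a • x = x

/-!
Write `N = [G, A]`. The heart of the matter is that in `T = ⟨a⟩ N`, for `a ∈ A`, two elements of
the same coset of `N` have the same `p ^ i`-th power if and only if their quotient is killed by
`p ^ i`. For `i = 1` and `p` odd one argues by induction on the order: in a group generated by two
elements, one of which has the same `p`-th power as its conjugate by the other, the induction
hypothesis in a maximal subgroup shows that the derived subgroup has exponent `p`. The elements
of order `p` of `γ_{p-1}(T) ≤ γ_p(G, A)` being central, the class is then less than `p`, and taking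
`p`-th powers is a homomorphism by a Hall-Petrescu type argument. For larger `i` one passes to the
quotient by the subgroup of the elements of order dividing `p`, which inherits the hypothesis.

Inside `N` this yields (i). Comparing `a` with its conjugates `g a g⁻¹`, it shows that
`a ^ p ^ i = 1` if and only if `p ^ i` kills every `[g, a]`, whence (ii) and (iii). Finally, if
`p ^ (m + 1)` kills `x ∈ γ_p(G, A)`, then `x ^ p ^ m` is fixed by `A`, so that `p ^ m` kills
`[x, a]`: each further commutation with `A` lowers the exponent, and (iv) follows.
-/

section Commutator

open scoped commutatorElement
open Subgroup

variable {G : Type*} [Group G]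

theorem commutatorElement_mul_mul (u x v y : G) :
    ⁅u * x, v * y⁆ = (u * ⁅x, v⁆ * u⁻¹) * ((u * ⁅v, ⁅x, y⁆⁆ * u⁻¹) * ⁅u, ⁅x, y⁆⁆) *
      (⁅x, y⁆ * ⁅u, v * y⁆ * ⁅x, y⁆⁻¹) * ⁅x, y⁆ := by
  simp only [commutatorElement_def]
  group

theorem commutatorElement_eq_inv_inv_mul_conj (x y : G) :
    ⁅x, y⁆ = x⁻¹⁻¹ * (y * x⁻¹ * y⁻¹) := by
  rw [commutatorElement_def, inv_inv, ← mul_assoc, ← mul_assoc]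

theorem commutatorElement_pow_left {x y : G} (h : Commute x ⁅x, y⁆) (n : ℕ) :
    ⁅x ^ n, y⁆ = ⁅x, y⁆ ^ n := by
  have hconj : y * x⁻¹ * y⁻¹ = x⁻¹ * ⁅x, y⁆ := by rw [commutatorElement_def]; group
  rw [commutatorElement_eq_inv_inv_mul_conj, ← inv_pow, ← conj_pow, hconj, h.inv_left.mul_pow,
    inv_mul_cancel_left]

theorem commutator_commutator_le_of_rotate {H₁ H₂ H₃ N : Subgroup G} [N.Normal]
    (h₁ : ⁅⁅H₂, H₃⁆, H₁⁆ ≤ N) (h₂ : ⁅⁅H₃, H₁⁆, H₂⁆ ≤ N) : ⁅⁅H₁, H₂⁆, H₃⁆ ≤ N := by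
  have le_iff (H : Subgroup G) : H ≤ N ↔ H.map (QuotientGroup.mk' N) = ⊥ := by
    rw [Subgroup.map_eq_bot_iff, QuotientGroup.ker_mk']
  rw [le_iff] at h₁ h₂ ⊢
  simp only [map_commutator] at h₁ h₂ ⊢
  exact commutator_commutator_eq_bot_of_rotate h₁ h₂

theorem commutator_le_iff_le_comap_centralizer {H K N : Subgroup G} [N.Normal] :
    ⁅H, K⁆ ≤ N ↔ H ≤ (centralizer (K.map (QuotientGroup.mk' N) : Set (G ⧸ N))).comap
      (QuotientGroup.mk' N) := by
  rw [← map_le_iff_le_comap, ← commutator_eq_bot_iff_le_centralizer, ← map_commutator,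
    Subgroup.map_eq_bot_iff, QuotientGroup.ker_mk']

theorem sup_commutator_le {H₁ H₂ K N : Subgroup G} [N.Normal] (h₁ : ⁅H₁, K⁆ ≤ N)
    (h₂ : ⁅H₂, K⁆ ≤ N) : ⁅H₁ ⊔ H₂, K⁆ ≤ N := by
  rw [commutator_le_iff_le_comap_centralizer] at *
  exact sup_le h₁ h₂

theorem commutator_sup_le {H K₁ K₂ N : Subgroup G} [N.Normal] (h₁ : ⁅H, K₁⁆ ≤ N)
    (h₂ : ⁅H, K₂⁆ ≤ N) : ⁅H, K₁ ⊔ K₂⁆ ≤ N := by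
  rw [commutator_comm] at *
  exact sup_commutator_le h₁ h₂

theorem normalClosure_commutator_le {H K N : Subgroup G} [K.Normal] [N.Normal]
    (h : ⁅H, K⁆ ≤ N) : ⁅normalClosure (H : Set G), K⁆ ≤ N := by
  rw [commutator_le_iff_le_comap_centralizer] at *
  have : (K.map (QuotientGroup.mk' N)).Normal :=
    Normal.map inferInstance _ (QuotientGroup.mk'_surjective N)
  exact normalClosure_le_normal h

theorem commutator_le_of_closure_pair {x y : G} (hxy : closure {x, y} = ⊤) {N : Subgroup G}
    [N.Normal] (h : ⁅x, y⁆ ∈ N) : _root_.commutator G ≤ N := by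
  have hcomm : (x : G ⧸ N) * y = y * x :=
    commutatorElement_eq_one_iff_mul_comm.1 ((QuotientGroup.eq_one_iff ⁅x, y⁆).2 h)
  have hclosure : closure {(x : G ⧸ N), (y : G ⧸ N)} = ⊤ := by
    rw [← map_top_of_surjective _ (QuotientGroup.mk'_surjective N), ← hxy, MonoidHom.map_closure,
      Set.image_pair]
    rfl
  have hclosureComm : IsMulCommutative (closure {(x : G ⧸ N), (y : G ⧸ N)}) :=
    isMulCommutative_closure (by rintro _ (rfl | rfl) _ (rfl | rfl) <;> simp [hcomm])
  rw [← Normal.quotient_commutative_iff_commutator_le]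
  refine ⟨⟨fun a b => ?_⟩⟩
  exact setLike_mul_comm (s := closure {(x : G ⧸ N), (y : G ⧸ N)}) (hclosure ▸ mem_top a)
    (hclosure ▸ mem_top b)

theorem commutator_lowerCentralSeries_le (i j : ℕ) :
    ⁅(⊤ : Subgroup G).lowerCentralSeries i, (⊤ : Subgroup G).lowerCentralSeries j⁆ ≤
      (⊤ : Subgroup G).lowerCentralSeries (i + j + 1) := by
  induction j generalizing i with
  | zero => exact le_rfl
  | succ j ih =>
    rw [commutator_comm, Subgroup.lowerCentralSeries_succ]
    refine commutator_commutator_le_of_rotate ?_ ?_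
    · rw [commutator_comm ⊤, ← Subgroup.lowerCentralSeries_succ, ← add_assoc, add_right_comm i j 1]
      exact ih (i + 1)
    · exact commutator_mono (ih i) le_rfl

end Commutator

section PolynomialSequence

open scoped commutatorElement

variable {G : Type*} [Group G]

/-- The sequences in `G` that are polynomial of weight `k` with respect to a filtration `F`, in the
sense of Lazard and Leibman. Closure under weighted commutators is part of the definition, so that
it need not be proved: only the behaviour under differences (`IsPolynomialSequence.exists_shift`)
matters here. -/
inductive IsPolynomialSequence (F : ℕ → Subgroup G) : ℕ → (ℕ → G) → Prop
  | binomial {g : G} {j k : ℕ} (hg : g ∈ F (j + k)) :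
      IsPolynomialSequence F k (fun n => g ^ n.choose j)
  | mul {k : ℕ} {f g : ℕ → G} (hf : IsPolynomialSequence F k f)
      (hg : IsPolynomialSequence F k g) : IsPolynomialSequence F k (f * g)
  | inv {k : ℕ} {f : ℕ → G} (hf : IsPolynomialSequence F k f) : IsPolynomialSequence F k f⁻¹
  | comm {i j : ℕ} {f g : ℕ → G} (hf : IsPolynomialSequence F i f)
      (hg : IsPolynomialSequence F j g) : IsPolynomialSequence F (i + j) ⁅f, g⁆
  | weaken {k : ℕ} {f : ℕ → G} (hf : IsPolynomialSequence F (k + 1) f) :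
      IsPolynomialSequence F k f

namespace IsPolynomialSequence

variable {F : ℕ → Subgroup G} {f g : ℕ → G} {i j k l m : ℕ}

theorem mono (hf : IsPolynomialSequence F l f) (h : k ≤ l) : IsPolynomialSequence F k f := by
  induction l, h using Nat.le_induction with
  | base => exact hf
  | succ l _ ih => exact ih hf.weaken

theorem one (k : ℕ) : IsPolynomialSequence F k (1 : ℕ → G) := by
  have := binomial (F := F) (j := 0) (one_mem (F (0 + k)))
  simp only [one_pow] at this
  exact this

theorem conj (hf : IsPolynomialSequence F i f) (hg : IsPolynomialSequence F k g) :
    IsPolynomialSequence F k (f * g * f⁻¹) := by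
  have := ((hf.comm hg).mono (Nat.le_add_left k i)).mul hg
  simpa [commutatorElement_def] using this

theorem apply_mem (hanti : Antitone F) (hcomm : ∀ i j, ⁅F i, F j⁆ ≤ F (i + j))
    (hf : IsPolynomialSequence F k f) (n : ℕ) : f n ∈ F k := by
  induction hf with
  | @binomial _ j k hg => exact pow_mem (hanti (Nat.le_add_left k j) hg) _
  | mul _ _ hf hg => exact mul_mem hf hg
  | inv _ hf => exact inv_mem hf
  | comm _ _ hf hg => exact hcomm _ _ (Subgroup.commutator_mem_commutator hf hg)
  | weaken _ hf => exact hanti (Nat.le_succ _) hf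

theorem exists_shift (hf : IsPolynomialSequence F k f) :
    ∃ u, IsPolynomialSequence F (k + 1) u ∧ (fun n => f (n + 1)) = u * f := by
  induction hf with
  | @binomial g j k hg =>
    cases j with
    | zero => exact ⟨1, one _, by ext n; simp⟩
    | succ j =>
      refine ⟨_, binomial (j := j) (k := k + 1) (by rwa [← add_assoc, add_right_comm]), ?_⟩
      ext n
      simp [Nat.choose_succ_succ, pow_add]
  | @mul k f g hf _ ihf ihg =>
    obtain ⟨u, hu, hfu⟩ := ihf
    obtain ⟨v, hv, hgv⟩ := ihg
    refine ⟨u * (f * v * f⁻¹), hu.mul (hf.conj hv), ?_⟩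
    change (fun n => f (n + 1)) * (fun n => g (n + 1)) = _
    rw [hfu, hgv]
    group
  | @inv k f hf ih =>
    obtain ⟨u, hu, hfu⟩ := ih
    refine ⟨f⁻¹ * u⁻¹ * f⁻¹⁻¹, hf.inv.conj hu.inv, ?_⟩
    change (fun n => f (n + 1))⁻¹ = _
    rw [hfu]
    group
  | @comm i j f g hf hg ihf ihg =>
    obtain ⟨u, hu, hfu⟩ := ihf
    obtain ⟨v, hv, hgv⟩ := ihg
    have hfg := hf.comm hg
    refine ⟨_, ?_, (congrArg₂ Bracket.bracket hfu hgv).trans (commutatorElement_mul_mul u f v g)⟩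
    refine ((hu.conj (hf.comm hv)).mul ((hu.conj ?_).mul ?_)).mul (hfg.conj ?_)
    · exact (hv.comm hfg).mono (by lia)
    · exact (hu.comm hfg).mono (by lia)
    · exact (hu.comm (hv.weaken.mul hg)).mono (by lia)
  | weaken _ ih =>
    obtain ⟨u, hu, hfu⟩ := ih
    exact ⟨u, hu.weaken, hfu⟩

theorem apply_mem_of_forall_lt (hanti : Antitone F) (hcomm : ∀ i j, ⁅F i, F j⁆ ≤ F (i + j))
    (hf : IsPolynomialSequence F k f) (hone : ∀ n < m, f n = 1) : f m ∈ F (k + m) := by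
  induction m generalizing f k with
  | zero => exact hf.apply_mem hanti hcomm 0
  | succ m ih =>
    obtain ⟨u, hu, hfu⟩ := hf.exists_shift
    have hval (n : ℕ) (hn : n ≤ m) : f (n + 1) = u n := by
      simpa [hone n (Nat.lt_succ_of_le hn)] using congrFun hfu n
    rw [hval m le_rfl, ← add_assoc, add_right_comm]
    exact ih hu fun n hn => by rw [← hval n hn.le, hone _ (Nat.succ_lt_succ hn)]

/-- Since `F p` is trivial, `f` has a Taylor expansion `f n = ∏ g_m ^ n.choose m` with `m < p`, and
`p` divides `p.choose m` for `0 < m < p`. -/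
theorem apply_prime_eq_one {p : ℕ} (hp : p.Prime) (hanti : Antitone F)
    (hcomm : ∀ i j, ⁅F i, F j⁆ ≤ F (i + j)) (hbot : F p = ⊥) (hexp : ∀ z ∈ F 2, z ^ p = 1)
    (hf : IsPolynomialSequence F 0 f) (h₀ : f 0 = 1) (h₁ : f 1 = 1) : f p = 1 := by
  suffices hstep : ∀ m ≤ p, 2 ≤ m → ∀ f : ℕ → G, IsPolynomialSequence F 0 f →
      (∀ n < m, f n = 1) → f p = 1 from
    hstep 2 hp.two_le le_rfl f hf fun n hn => by interval_cases n <;> assumption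
  intro m hmp
  induction hmp using Nat.decreasingInduction with
  | self =>
    intro _ f hf hone
    have := hf.apply_mem_of_forall_lt hanti hcomm hone
    rwa [zero_add, hbot, Subgroup.mem_bot] at this
  | of_succ m hmp ih =>
    intro hm f hf hone
    have hfm : f m ∈ F m := by simpa using hf.apply_mem_of_forall_lt hanti hcomm hone
    have hpow : f m ^ p.choose m = 1 := by
      obtain ⟨c, hc⟩ := hp.dvd_choose_self (by lia) hmp
      rw [hc, pow_mul, hexp _ (hanti hm hfm), one_pow]
    have := ih (by lia) _ (hf.mul (binomial (j := m) (k := 0) hfm).inv) fun n hn => by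
      rcases Nat.lt_succ_iff_lt_or_eq.1 hn with hnm | rfl
      · simp [hone n hnm, Nat.choose_eq_zero_of_lt hnm]
      · simp
    simpa [hpow] using this

end IsPolynomialSequence

theorem mul_pow_prime_of_lowerCentralSeries_eq_bot {p : ℕ} (hp : p.Prime)
    (hbot : (⊤ : Subgroup G).lowerCentralSeries (p - 1) = ⊥)
    (hexp : ∀ z ∈ commutator G, z ^ p = 1) (x y : G) : (x * y) ^ p = x ^ p * y ^ p := by
  let F : ℕ → Subgroup G := fun i => (⊤ : Subgroup G).lowerCentralSeries (i - 1)
  have hanti : Antitone F := fun i j h =>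
    Subgroup.lowerCentralSeries_antitone _ (Nat.sub_le_sub_right h 1)
  have hcomm : ∀ i j, ⁅F i, F j⁆ ≤ F (i + j)
    | 0, j => by simpa [F] using Subgroup.commutator_le_right _ _
    | i, 0 => by simpa [F] using Subgroup.commutator_le_left _ _
    | i + 1, j + 1 => by
      simpa [F, show i + 1 + (j + 1) - 1 = i + j + 1 by lia] using
        commutator_lowerCentralSeries_le i j
  have hpow (z : G) : IsPolynomialSequence F 0 (fun n => z ^ n.choose 1) :=
    .binomial (by simp [F])
  have := (((hpow (x * y)).inv.mul (hpow x)).mul (hpow y)).apply_prime_eq_one hp hanti hcomm hbot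
    hexp (by simp) (by simp)
  simpa [mul_assoc, inv_mul_eq_one] using this

end PolynomialSequence

section Omega

variable {L : Type*} [Group L]

/-- `Ω(K, n)`: the subgroup generated by the elements of `K` whose order divides `n`. The exponent
itself is the index, so that the classical `Ω_i` of a `p`-group is the case `n = p ^ i`. -/
def omegaSubgroup (K : Subgroup L) (n : ℕ) : Subgroup L :=
  Subgroup.closure {z | z ∈ K ∧ z ^ n = 1}

instance omegaSubgroup_normal (K : Subgroup L) [hK : K.Normal] (n : ℕ) :
    (omegaSubgroup K n).Normal := by
  refine Subgroup.normalizer_eq_top_iff.1 (top_le_iff.1 (le_trans ?_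
    (Subgroup.normalizer_le_normalizer_closure _)))
  refine Subgroup.le_set_normalizer_iff.2 fun g _ z hz => ⟨hK.conj_mem z hz.1 g, ?_⟩
  rw [conj_pow, hz.2, mul_one, mul_inv_cancel]

theorem mem_omegaSubgroup_iff {K : Subgroup L} {n : ℕ}
    (h : ∀ x ∈ K, ∀ y ∈ K, x ^ n = 1 → y ^ n = 1 → (x⁻¹ * y) ^ n = 1) {z : L} :
    z ∈ omegaSubgroup K n ↔ z ∈ K ∧ z ^ n = 1 := by
  refine ⟨fun hz => ?_, fun hz => Subgroup.subset_closure hz⟩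
  induction hz using Subgroup.closure_induction with
  | mem _ hz => exact hz
  | one => exact ⟨one_mem K, one_pow n⟩
  | mul x y _ _ hx hy =>
    refine ⟨mul_mem hx.1 hy.1, ?_⟩
    simpa using h x⁻¹ (inv_mem hx.1) y hy.1 (by rw [inv_pow, hx.2, inv_one]) hy.2
  | inv x _ hx => exact ⟨inv_mem hx.1, by rw [inv_pow, hx.2, inv_one]⟩

theorem coe_omegaSubgroup_top {n : ℕ}
    (h : ∀ x y : L, x ^ n = 1 → y ^ n = 1 → (x⁻¹ * y) ^ n = 1) :
    (omegaSubgroup (⊤ : Subgroup L) n : Set L) = {x | orderOf x ∣ n} := by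
  ext x
  rw [SetLike.mem_coe, mem_omegaSubgroup_iff fun x _ y _ => h x y, Set.mem_ofPred_eq,
    orderOf_dvd_iff_pow_eq_one, and_iff_right (Subgroup.mem_top x)]

end Omega

section PowerMap

open scoped commutatorElement

variable {L : Type*} [Group L]

theorem pow_eq_one_of_mem_commutator_of_closure_pair [Group.IsNilpotent L]
    [IsCoatomic (Subgroup L)] {a b : L} {n : ℕ} (hab : Subgroup.closure {a, b} = ⊤)
    (hconj : a ^ n = (b * a * b⁻¹) ^ n)
    (hproper : ∀ M : Subgroup L, M ≠ ⊤ → ∀ u ∈ M, ∀ v ∈ M, u ^ n = v ^ n → (u⁻¹ * v) ^ n = 1) :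
    ∀ z ∈ commutator L, z ^ n = 1 := by
  by_cases ha : Subgroup.zpowers a = ⊤
  · have : IsCyclic L := isCyclic_iff_exists_zpowers_eq_top.2 ⟨a, ha⟩
    simp [commutator_eq_bot]
  obtain ⟨M, hM, haM⟩ := (eq_top_or_exists_le_coatom (Subgroup.zpowers a)).resolve_left ha
  have hMnormal : M.Normal := Subgroup.NormalizerCondition.normal_of_coatom M
    Group.normalizerCondition_of_isNilpotent hM
  have haM : a⁻¹ ∈ M := inv_mem (haM (Subgroup.mem_zpowers a))
  have hbM : b * a⁻¹ * b⁻¹ ∈ M := hMnormal.conj_mem _ haM b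
  have hΩ {z : L} : z ∈ omegaSubgroup M n ↔ z ∈ M ∧ z ^ n = 1 :=
    mem_omegaSubgroup_iff fun u hu v hv hun hvn => hproper M hM.1 u hu v hv (hun.trans hvn.symm)
  have hmem : ⁅a, b⁆ ∈ omegaSubgroup M n := by
    rw [hΩ, commutatorElement_eq_inv_inv_mul_conj]
    refine ⟨mul_mem (inv_mem haM) hbM, hproper M hM.1 _ haM _ hbM ?_⟩
    rw [← conj_inv, inv_pow, inv_pow, hconj]
  exact fun z hz => (hΩ.1 (commutator_le_of_closure_pair hab hmem hz)).2

theorem mul_pow_prime_of_odd {p : ℕ} [hp : Fact p.Prime] (hodd : p ≠ 2)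
    (hcen : ∀ z ∈ (⊤ : Subgroup L).lowerCentralSeries (p - 2), z ^ p = 1 → z ∈ Subgroup.center L)
    (hexp : ∀ z ∈ commutator L, z ^ p = 1) (x y : L) : (x * y) ^ p = x ^ p * y ^ p := by
  have hp3 : 3 ≤ p := hp.out.two_le.lt_of_ne' hodd
  refine mul_pow_prime_of_lowerCentralSeries_eq_bot hp.out ?_ hexp x y
  rw [show p - 1 = p - 2 + 1 by lia, Subgroup.lowerCentralSeries_succ,
    Subgroup.commutator_top_right_eq_bot_iff_le_center]
  exact fun z hz =>
    hcen z hz (hexp z (Subgroup.lowerCentralSeries_antitone _ (show 1 ≤ p - 2 by lia) hz))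

theorem pow_prime_eq_iff_of_odd {p : ℕ} [Fact p.Prime] (hodd : p ≠ 2) [Finite L]
    (hL : IsPGroup p L)
    (hcen : ∀ z ∈ (⊤ : Subgroup L).lowerCentralSeries (p - 2), z ^ p = 1 → z ∈ Subgroup.center L)
    (x y : L) : x ^ p = y ^ p ↔ (x⁻¹ * y) ^ p = 1 := by
  induction hn : Nat.card L using Nat.strong_induction_on generalizing L with
  | _ n ih =>
  have hproper (M : Subgroup L) (hM : M ≠ ⊤) (u : L) (hu : u ∈ M) (v : L) (hv : v ∈ M) :
      u ^ p = v ^ p ↔ (u⁻¹ * v) ^ p = 1 := by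
    have hcard : Nat.card M < n := by
      rw [← hn]
      exact M.card_le_card_group.lt_of_ne fun h => hM (Subgroup.eq_top_of_card_eq M h)
    have := ih _ hcard (hL.to_subgroup M) (fun z hz hzp => ?_) ⟨u, hu⟩ ⟨v, hv⟩ rfl
    · simpa [Subtype.ext_iff] using this
    · have hzL : (z : L) ∈ (⊤ : Subgroup L).lowerCentralSeries (p - 2) :=
        Subgroup.lowerCentralSeries_mono _ le_top
          (M.top_subtype_lowerCentralSeries (p - 2) ▸ Subgroup.mem_map_of_mem M.subtype hz)
      have hzcen := Subgroup.mem_center_iff.1 (hcen z hzL (by simpa [Subtype.ext_iff] using hzp))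
      exact Subgroup.mem_center_iff.2 fun g => Subtype.ext (hzcen g)
  have hmul {a b : L} (hab : Subgroup.closure {a, b} = ⊤) (hconj : a ^ p = (b * a * b⁻¹) ^ p)
      (u v : L) : (u * v) ^ p = u ^ p * v ^ p := by
    have := hL.isNilpotent
    exact mul_pow_prime_of_odd hodd hcen (pow_eq_one_of_mem_commutator_of_closure_pair hab hconj
      fun M hM u hu v hv => (hproper M hM u hu v hv).1) u v
  by_cases hxy : Subgroup.closure {x, y} = ⊤
  · constructor <;> intro h
    · rw [hmul hxy (by rw [conj_pow, h]; group), inv_pow, h, inv_mul_cancel]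
    · have hclosure : Subgroup.closure {x⁻¹ * y, y} = ⊤ := by
        rw [← top_le_iff, ← hxy, Subgroup.closure_le, Set.pair_subset_iff]
        have hleft : x⁻¹ * y ∈ Subgroup.closure {x⁻¹ * y, y} := Subgroup.subset_closure (by simp)
        have hright : y ∈ Subgroup.closure {x⁻¹ * y, y} := Subgroup.subset_closure (by simp)
        exact ⟨by simpa using mul_mem hright (inv_mem hleft), hright⟩
      have := hmul hclosure (by rw [conj_pow, h]; group) x (x⁻¹ * y)
      rwa [h, mul_one, mul_inv_cancel_left, eq_comm] at this
  · exact hproper _ hxy x (Subgroup.subset_closure (by simp)) y (Subgroup.subset_closure (by simp))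

theorem sq_eq_one_of_conj_eq_inv {x c : L} (hinv : x⁻¹ * c * x = c⁻¹)
    (hcomm : ∀ d ∈ Subgroup.zpowers c, d ^ 4 = 1 → Commute x d) {k : ℕ} (hk : c ^ 2 ^ k = 1) :
    c ^ 2 = 1 := by
  induction k with
  | zero => simp_all
  | succ k ih =>
    rcases k with _ | k
    · exact hk
    refine ih ?_
    have hcomm' : Commute x (c ^ 2 ^ k) :=
      hcomm _ (pow_mem (Subgroup.mem_zpowers c) _) (by rw [← pow_mul, ← hk]; ring_nf)
    have hconj : (c ^ 2 ^ k)⁻¹ = c ^ 2 ^ k := by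
      have := conj_pow (i := 2 ^ k) (a := x⁻¹) (b := c)
      rwa [inv_inv, hinv, inv_pow, mul_assoc, ← hcomm'.eq, inv_mul_cancel_left] at this
    rw [pow_succ, pow_mul, pow_two, ← inv_eq_iff_mul_eq_one, hconj]

theorem sq_eq_mul_sq_iff {x c : L} (hcomm : ∀ d ∈ Subgroup.zpowers c, d ^ 4 = 1 → Commute x d)
    (hc : ∃ k : ℕ, c ^ 2 ^ k = 1) : x ^ 2 = (x * c) ^ 2 ↔ c ^ 2 = 1 := by
  constructor <;> intro h
  · obtain ⟨k, hk⟩ := hc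
    refine sq_eq_one_of_conj_eq_inv ?_ hcomm hk
    have : x * x = x * (c * x * c) := by simpa only [pow_two, mul_assoc] using h
    rw [eq_inv_iff_mul_eq_one, mul_assoc, mul_assoc, inv_mul_eq_one, ← mul_assoc]
    exact mul_left_cancel this
  · have hxc := hcomm c (Subgroup.mem_zpowers c)
      (by rw [show 4 = 2 * 2 from rfl, pow_mul, h, one_pow])
    rw [hxc.mul_pow, h, mul_one]

end PowerMap

section PCentralPair

variable {p : ℕ} {L : Type*} [Group L]

/-- The hypothesis under which `p`-th powers determine the elements of a coset of `K` up to elements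
of order dividing `p`: the group `L` is abelian modulo `K`, and the elements of order dividing `p`
(dividing `4` if `p = 2`) of `K ∩ γ_{p-1}(L)` are central in `L`. It passes to the quotient by
`omegaSubgroup K p`, and it is met by `L = ⟨a⟩ [G, A]` and `K = [G, A]` for `a ∈ A`. Since
`lowerCentralSeries` starts at `0`, the index `p - 2` stands for `γ_{p-1}`. -/
structure IsPCentralPair (p : ℕ) (K : Subgroup L) : Prop where
  commutator_le : commutator L ≤ K
  mem_center : ∀ z ∈ K, z ∈ (⊤ : Subgroup L).lowerCentralSeries (p - 2) →
    z ^ (if p = 2 then 4 else p) = 1 → z ∈ Subgroup.center L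

namespace IsPCentralPair

variable {K : Subgroup L}

theorem normal (h : IsPCentralPair p K) : K.Normal :=
  Subgroup.Normal.of_commutator_le L h.commutator_le

theorem pow_prime_eq_iff [hp : Fact p.Prime] [Finite L] (hL : IsPGroup p L)
    (h : IsPCentralPair p K) {x y : L} (hxy : x⁻¹ * y ∈ K) :
    x ^ p = y ^ p ↔ (x⁻¹ * y) ^ p = 1 := by
  rcases eq_or_ne p 2 with rfl | hodd
  · have hcomm : ∀ d ∈ Subgroup.zpowers (x⁻¹ * y), d ^ 4 = 1 → Commute x d := fun d hd hd4 =>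
      Subgroup.mem_center_iff.1
        (h.mem_center d (Subgroup.zpowers_le.2 hxy hd) (by simp) (by simpa using hd4)) x
    simpa using sq_eq_mul_sq_iff hcomm (hL (x⁻¹ * y))
  · have hp3 : 3 ≤ p := hp.out.two_le.lt_of_ne' hodd
    refine pow_prime_eq_iff_of_odd hodd hL (fun z hz hzp => ?_) x y
    have hzK : z ∈ K :=
      h.commutator_le (Subgroup.lowerCentralSeries_antitone _ (show 1 ≤ p - 2 by lia) hz)
    exact h.mem_center z hzK hz (by simpa [hodd] using hzp)

variable [Fact p.Prime] [Finite L]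

theorem mem_omegaSubgroup (hL : IsPGroup p L) (h : IsPCentralPair p K) {z : L} :
    z ∈ omegaSubgroup K p ↔ z ∈ K ∧ z ^ p = 1 :=
  mem_omegaSubgroup_iff fun _ hx _ hy hxp hyp =>
    (h.pow_prime_eq_iff hL (mul_mem (inv_mem hx) hy)).1 (hxp.trans hyp.symm)

theorem mk_mem_center [K.Normal] (hL : IsPGroup p L) (h : IsPCentralPair p K) {w : L}
    (hw : w ∈ K) (hwp : w ^ p ∈ Subgroup.center L) :
    QuotientGroup.mk' (omegaSubgroup K p) w ∈ Subgroup.center (L ⧸ omegaSubgroup K p) := by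
  refine Subgroup.mem_center_iff.2 fun g => ?_
  obtain ⟨g, rfl⟩ := QuotientGroup.mk'_surjective _ g
  have hmem : w⁻¹ * (g * w * g⁻¹) ∈ K :=
    mul_mem (inv_mem hw) (Subgroup.Normal.conj_mem inferInstance w hw g)
  have hpow : (w⁻¹ * (g * w * g⁻¹)) ^ p = 1 := by
    rw [← h.pow_prime_eq_iff hL hmem, conj_pow, Subgroup.mem_center_iff.1 hwp g,
      mul_inv_cancel_right]
  have hmk : QuotientGroup.mk' (omegaSubgroup K p) (w⁻¹ * (g * w * g⁻¹)) = 1 :=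
    (QuotientGroup.eq_one_iff _).2 ((h.mem_omegaSubgroup hL).2 ⟨hmem, hpow⟩)
  rw [map_mul, map_inv, inv_mul_eq_one, map_mul, map_mul, map_inv, eq_mul_inv_iff_mul_eq] at hmk
  exact hmk.symm

theorem quotient [K.Normal] (hL : IsPGroup p L) (h : IsPCentralPair p K) :
    IsPCentralPair p (K.map (QuotientGroup.mk' (omegaSubgroup K p))) := by
  have hlcs (k : ℕ) : ((⊤ : Subgroup L).lowerCentralSeries k).map
      (QuotientGroup.mk' (omegaSubgroup K p)) = (⊤ : Subgroup _).lowerCentralSeries k := by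
    rw [Subgroup.map_lowerCentralSeries,
      Subgroup.map_top_of_surjective _ (QuotientGroup.mk'_surjective _)]
  refine ⟨?_, fun z hzK hz hzp => ?_⟩
  · rw [← Subgroup.top_lowerCentralSeries_one, ← hlcs]
    exact Subgroup.map_mono h.commutator_le
  · rw [← hlcs] at hz
    obtain ⟨w, hw, rfl⟩ := hz
    have hwK : w ∈ K := by
      obtain ⟨v, hv, hvw⟩ := hzK
      simpa using mul_mem hv ((h.mem_omegaSubgroup hL).1 (QuotientGroup.eq.1 hvw)).1
    rw [← map_pow, ← MonoidHom.mem_ker, QuotientGroup.ker_mk', h.mem_omegaSubgroup hL] at hzp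
    refine h.mk_mem_center hL hwK (h.mem_center _ (pow_mem hwK p) (pow_mem hw p) ?_)
    rw [← pow_mul, mul_comm, pow_mul, hzp.2]

theorem pow_prime_pow_eq_iff (hL : IsPGroup p L) (h : IsPCentralPair p K) (i : ℕ) {x y : L}
    (hxy : x⁻¹ * y ∈ K) : x ^ p ^ i = y ^ p ^ i ↔ (x⁻¹ * y) ^ p ^ i = 1 := by
  induction i generalizing L with
  | zero => simp [inv_mul_eq_one]
  | succ i ih =>
    have := h.normal
    have hmem : (x ^ p ^ i)⁻¹ * y ^ p ^ i ∈ K := by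
      rw [← QuotientGroup.eq] at hxy ⊢
      simp [hxy]
    let π := QuotientGroup.mk' (omegaSubgroup K p)
    have hker {z : L} (hz : z ∈ K) : π z = 1 ↔ z ^ p = 1 := by
      rw [← MonoidHom.mem_ker, QuotientGroup.ker_mk', h.mem_omegaSubgroup hL, and_iff_right hz]
    calc x ^ p ^ (i + 1) = y ^ p ^ (i + 1)
        ↔ (x ^ p ^ i) ^ p = (y ^ p ^ i) ^ p := by rw [pow_succ, pow_mul, pow_mul]
      _ ↔ π ((x ^ p ^ i)⁻¹ * y ^ p ^ i) = 1 := by rw [h.pow_prime_eq_iff hL hmem, hker hmem]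
      _ ↔ π x ^ p ^ i = π y ^ p ^ i := by
        rw [map_mul, map_inv, map_pow, map_pow, inv_mul_eq_one]
      _ ↔ ((π x)⁻¹ * π y) ^ p ^ i = 1 :=
        ih (hL.to_quotient _) (h.quotient hL)
          (by rw [← map_inv, ← map_mul]; exact Subgroup.mem_map_of_mem π hxy)
      _ ↔ (x⁻¹ * y) ^ p ^ (i + 1) = 1 := by
        rw [← map_inv, ← map_mul, ← map_pow, hker (pow_mem hxy _), ← pow_mul, ← pow_succ]

end IsPCentralPair

end PCentralPair

section ActionSeries

open scoped commutatorElement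
open Subgroup

variable {P : Type*} [Group P]

/-- The series `G`, `[G, A]`, `[G, A, A]`, …, where at each step one takes the normal closure, so
that all terms but the first are normal even if `A` does not normalize them a priori. For the
semidirect product of `G` and `A` the `k`-th term lies in `γ_{k+1}(G, A)`. -/
def actionSeries (G A : Subgroup P) : ℕ → Subgroup P
  | 0 => G
  | k + 1 => normalClosure (⁅actionSeries G A k, A⁆ : Subgroup P)

variable (G A : Subgroup P)

theorem commutator_actionSeries_le_succ (k : ℕ) :
    ⁅actionSeries G A k, A⁆ ≤ actionSeries G A (k + 1) :=
  subset_normalClosure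

theorem le_centralizer_actionSeries_one {N : Subgroup P} [N.Normal]
    (h : N ≤ centralizer (A : Set P)) : N ≤ centralizer (actionSeries G A 1 : Set P) := by
  rw [← commutator_eq_bot_iff_le_centralizer] at h ⊢
  rw [commutator_comm, ← le_bot_iff]
  refine normalClosure_commutator_le (commutator_commutator_le_of_rotate ?_ ?_)
  · rw [commutator_comm A, h, commutator_bot_left]
  · exact (commutator_mono (commutator_le_left N _) le_rfl).trans h.le

variable [G.Normal]

instance actionSeries_normal (k : ℕ) : (actionSeries G A k).Normal := by
  cases k
  · assumption
  · exact normalClosure_normal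

theorem actionSeries_antitone : Antitone (actionSeries G A) :=
  antitone_nat_of_succ_le fun _ => normalClosure_le_normal (commutator_le_left _ _)

theorem actionSeries_le (k : ℕ) : actionSeries G A k ≤ G :=
  actionSeries_antitone G A (Nat.zero_le k)

theorem commutator_actionSeries_le (i j : ℕ) :
    ⁅actionSeries G A i, actionSeries G A j⁆ ≤ actionSeries G A (i + j) := by
  induction j generalizing i with
  | zero => exact commutator_le_left _ _
  | succ j ih =>
    rw [commutator_comm]
    refine normalClosure_commutator_le (commutator_commutator_le_of_rotate ?_ ?_)
    · rw [commutator_comm A, ← add_assoc, add_right_comm]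
      exact (commutator_mono (commutator_actionSeries_le_succ G A i) le_rfl).trans (ih (i + 1))
    · exact (commutator_mono (ih i) le_rfl).trans (commutator_actionSeries_le_succ G A _)

theorem commutator_actionSeries_lowerCentralSeries_le (i k : ℕ) :
    ⁅actionSeries G A i, A.lowerCentralSeries k⁆ ≤ actionSeries G A (i + k + 1) := by
  induction k generalizing i with
  | zero => exact commutator_actionSeries_le_succ G A i
  | succ k ih =>
    rw [commutator_comm, Subgroup.lowerCentralSeries_succ]
    refine commutator_commutator_le_of_rotate ?_ ?_
    · rw [commutator_comm A, ← add_assoc, add_right_comm i k 1]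
      exact (commutator_mono (commutator_actionSeries_le_succ G A i) le_rfl).trans (ih (i + 1))
    · exact (commutator_mono (ih i) le_rfl).trans (commutator_actionSeries_le_succ G A _)

theorem lowerCentralSeries_actionSeries_one_le (k : ℕ) :
    (actionSeries G A 1).lowerCentralSeries k ≤ actionSeries G A (k + 1) := by
  induction k with
  | zero => exact le_rfl
  | succ k ih =>
    exact (commutator_mono ih le_rfl).trans (commutator_actionSeries_le G A (k + 1) 1)

theorem lowerCentralSeries_zpowers_sup_le {a : P} (ha : a ∈ A) (k : ℕ) :
    (zpowers a ⊔ actionSeries G A 1).lowerCentralSeries (k + 1) ≤ actionSeries G A (k + 2) := by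
  have hzpowers (i : ℕ) : ⁅actionSeries G A i, zpowers a⁆ ≤ actionSeries G A (i + 1) :=
    (commutator_mono le_rfl (zpowers_le.2 ha)).trans (commutator_actionSeries_le_succ G A i)
  have hcomm (i : ℕ) :
      ⁅actionSeries G A i, zpowers a ⊔ actionSeries G A 1⁆ ≤ actionSeries G A (i + 1) :=
    commutator_sup_le (hzpowers i) (commutator_actionSeries_le G A i 1)
  induction k with
  | zero =>
    refine sup_commutator_le (commutator_sup_le ?_ ?_) (hcomm 1)
    · rw [commutator_self_eq_bot_iff.2 inferInstance]
      exact bot_le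
    · rw [commutator_comm]
      exact hzpowers 1
  | succ k ih =>
    rw [Subgroup.lowerCentralSeries_succ]
    exact (commutator_mono ih le_rfl).trans (hcomm (k + 2))

end ActionSeries

section PCentralAction

open scoped commutatorElement
open Subgroup

/-- The elements of order dividing `p` (dividing `4` if `p = 2`) of the term with index `p - 1` of
`actionSeries G A` commute with `A`. This is how the hypothesis that `A` acts `p`-centrally on
`γ_p(G, A)` reads in the semidirect product of `G` and `A`. -/
def IsPCentralAction (p : ℕ) {P : Type*} [Group P] (G A : Subgroup P) : Prop :=
  ∀ z ∈ actionSeries G A (p - 1), z ^ (if p = 2 then 4 else p) = 1 → ∀ a ∈ A, Commute a z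

variable {p : ℕ} {P : Type*} [Group P] {G A : Subgroup P} [G.Normal]

theorem commute_of_coprime_of_actionSeries_succ (hG : IsPGroup p G) {a : P} (ha : a ∈ A)
    (hap : (orderOf a).Coprime p) {k : ℕ} (h : ∀ x ∈ actionSeries G A (k + 1), Commute a x) {x : P}
    (hx : x ∈ actionSeries G A k) : Commute a x := by
  have hmem : ⁅a, x⁆ ∈ actionSeries G A (k + 1) := by
    refine commutator_actionSeries_le_succ G A k ?_
    rw [commutator_comm]
    exact commutator_mem_commutator ha hx
  have hpow : ⁅a, x⁆ ^ orderOf a = 1 := by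
    rw [← commutatorElement_pow_left (h _ hmem), pow_orderOf_eq_one, commutatorElement_one_left]
  have hcop : (orderOf ⁅a, x⁆).Coprime (orderOf a) := by
    simpa using hG.orderOf_coprime hap.symm ⟨_, actionSeries_le G A _ hmem⟩
  rw [← commutatorElement_eq_one_iff_commute, ← orderOf_eq_one_iff]
  exact hcop.eq_one_of_dvd (orderOf_dvd_of_pow_eq_one hpow)

theorem commute_of_coprime (hG : IsPGroup p G) {m : ℕ} (hm : actionSeries G A m = ⊥) {a : P}
    (ha : a ∈ A) (hap : (orderOf a).Coprime p) {g : P} (hg : g ∈ G) : Commute a g := by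
  suffices H : ∀ k ≤ m, ∀ x ∈ actionSeries G A k, Commute a x from H 0 (Nat.zero_le m) g hg
  intro k hk
  induction hk using Nat.decreasingInduction with
  | self =>
    intro x hx
    rw [hm, mem_bot] at hx
    exact hx ▸ Commute.one_right a
  | of_succ k _ ih => exact fun x hx => commute_of_coprime_of_actionSeries_succ hG ha hap ih hx

namespace IsPCentralAction

theorem commute_actionSeries_one (h : IsPCentralAction p G A) {z : P}
    (hz : z ∈ actionSeries G A (p - 1)) (hzp : z ^ (if p = 2 then 4 else p) = 1) {x : P}
    (hx : x ∈ actionSeries G A 1) : Commute x z := by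
  have hΩ : omegaSubgroup (actionSeries G A (p - 1)) (if p = 2 then 4 else p) ≤
      centralizer (A : Set P) :=
    (closure_le _).2 fun w hw => h w hw.1 hw.2
  exact le_centralizer_actionSeries_one G A hΩ (subset_closure ⟨hz, hzp⟩) x hx

variable [hp : Fact p.Prime]

theorem isPCentralPair (h : IsPCentralAction p G A) {a : P} (ha : a ∈ A) :
    IsPCentralPair p ((actionSeries G A 1).subgroupOf (zpowers a ⊔ actionSeries G A 1)) := by
  set T := zpowers a ⊔ actionSeries G A 1
  have hlcs {k : ℕ} {z : T} (hz : z ∈ (⊤ : Subgroup T).lowerCentralSeries k) :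
      (z : P) ∈ T.lowerCentralSeries k :=
    top_subtype_lowerCentralSeries T k ▸ mem_map_of_mem T.subtype hz
  refine ⟨fun z hz => ?_, fun z hzN hz hzp => ?_⟩
  · exact actionSeries_antitone G A one_le_two
      (lowerCentralSeries_zpowers_sup_le G A ha 0 (hlcs (k := 1) hz))
  · have hzN : (z : P) ∈ actionSeries G A (p - 1) := by
      rcases eq_or_ne p 2 with rfl | hodd
      · exact hzN
      · have hp3 : 3 ≤ p := hp.out.two_le.lt_of_ne' hodd
        obtain ⟨k, rfl⟩ := Nat.exists_eq_add_of_le' hp3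
        exact lowerCentralSeries_zpowers_sup_le G A ha k (hlcs hz)
    have hzp : (z : P) ^ (if p = 2 then 4 else p) = 1 := by rw [← coe_pow, hzp, coe_one]
    have hT : T ≤ centralizer {(z : P)} :=
      sup_le (zpowers_le.2 (mem_centralizer_singleton_iff.2 (h z hzN hzp a ha)))
        fun x hx => mem_centralizer_singleton_iff.2 (h.commute_actionSeries_one hzN hzp hx)
    exact mem_center_iff.2 fun g => Subtype.ext (mem_centralizer_singleton_iff.1 (hT g.2))

variable [Finite G]

theorem pow_prime_pow_eq_iff (hG : IsPGroup p G) (h : IsPCentralAction p G A) {a : P}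
    (ha : a ∈ A) (hap : IsPGroup p (zpowers a)) (i : ℕ) {x y : P}
    (hx : x ∈ zpowers a ⊔ actionSeries G A 1) (hxy : x⁻¹ * y ∈ actionSeries G A 1) :
    x ^ p ^ i = y ^ p ^ i ↔ (x⁻¹ * y) ^ p ^ i = 1 := by
  set T := zpowers a ⊔ actionSeries G A 1
  have hy : y ∈ T := by simpa using mul_mem hx (le_sup_right (a := zpowers a) hxy)
  have hTp : IsPGroup p T :=
    hap.to_sup_of_normal_right (hG.to_le (actionSeries_le G A 1))
  have hTfin : Finite T := by
    have ha : (zpowers a : Set P).Finite :=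
      finite_zpowers.2 ((zpowers a).subtype.isOfFinOrder
        (hap.isOfFinOrder hp.out.ne_zero ⟨a, mem_zpowers a⟩))
    have hN : (actionSeries G A 1 : Set P).Finite :=
      (Set.toFinite (G : Set P)).subset (actionSeries_le G A 1)
    exact Set.Finite.to_subtype (mul_normal (zpowers a) (actionSeries G A 1) ▸ ha.mul hN)
  have := (h.isPCentralPair ha).pow_prime_pow_eq_iff hTp i (x := ⟨x, hx⟩) (y := ⟨y, hy⟩) hxy
  simpa [Subtype.ext_iff] using this

theorem inv_mul_pow_eq_one (hG : IsPGroup p G) (h : IsPCentralAction p G A) (i : ℕ) {x y : P}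
    (hx : x ∈ actionSeries G A 1) (hy : y ∈ actionSeries G A 1) (hxy : x ^ p ^ i = y ^ p ^ i) :
    (x⁻¹ * y) ^ p ^ i = 1 := by
  have hone : IsPGroup p (zpowers (1 : P)) := by
    rw [zpowers_one_eq_bot]
    exact .of_bot
  exact (h.pow_prime_pow_eq_iff hG (one_mem A) hone i (le_sup_right (a := zpowers (1 : P)) hx)
    (mul_mem (inv_mem hx) hy)).1 hxy

theorem mem_omegaSubgroup (hG : IsPGroup p G) (h : IsPCentralAction p G A) {i : ℕ} {z : P} :
    z ∈ omegaSubgroup (actionSeries G A 1) (p ^ i) ↔ z ∈ actionSeries G A 1 ∧ z ^ p ^ i = 1 :=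
  mem_omegaSubgroup_iff fun _ hx _ hy hxi hyi =>
    h.inv_mul_pow_eq_one hG i hx hy (hxi.trans hyi.symm)

theorem commutator_mem_omegaSubgroup (hG : IsPGroup p G) (h : IsPCentralAction p G A) {m : ℕ}
    {x : P} (hx : x ∈ actionSeries G A (p - 1)) (hxm : x ^ p ^ (m + 1) = 1) {a : P} (ha : a ∈ A) :
    ⁅x, a⁆ ∈ omegaSubgroup (actionSeries G A 1) (p ^ m) := by
  have hxinv : x⁻¹ ∈ actionSeries G A 1 :=
    inv_mem (actionSeries_antitone G A (Nat.le_sub_one_of_lt hp.out.one_lt) hx)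
  have hconj : a * x⁻¹ * a⁻¹ ∈ actionSeries G A 1 := Normal.conj_mem inferInstance _ hxinv a
  have hcomm : Commute a (x⁻¹ ^ p ^ m) := by
    have hpow : (x⁻¹ ^ p ^ m) ^ p = 1 := by rw [← pow_mul, ← pow_succ, inv_pow, hxm, inv_one]
    refine h _ (pow_mem (inv_mem hx) _) ?_ a ha
    split_ifs with htwo
    · subst htwo
      rw [show 4 = 2 * 2 from rfl, pow_mul, hpow, one_pow]
    · exact hpow
  rw [h.mem_omegaSubgroup hG, commutatorElement_eq_inv_inv_mul_conj]
  refine ⟨mul_mem (inv_mem hxinv) hconj, h.inv_mul_pow_eq_one hG m hxinv hconj ?_⟩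
  rw [conj_pow, hcomm.eq, mul_inv_cancel_right]

theorem actionSeries_le_omegaSubgroup (hG : IsPGroup p G) (h : IsPCentralAction p G A) {j m : ℕ}
    (hexp : ∀ z ∈ actionSeries G A 1, z ^ p ^ (m + j) = 1) :
    actionSeries G A (p - 1 + j) ≤ omegaSubgroup (actionSeries G A 1) (p ^ m) := by
  induction j generalizing m with
  | zero =>
    intro z hz
    have hz1 := actionSeries_antitone G A (Nat.le_sub_one_of_lt hp.out.one_lt) hz
    exact subset_closure ⟨hz1, hexp z hz1⟩
  | succ j ih =>
    have hle := ih (m := m + 1) (by rwa [add_assoc, add_comm 1 j])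
    refine normalClosure_le_normal (commutator_le.2 fun x hx a ha => ?_)
    exact h.commutator_mem_omegaSubgroup hG (actionSeries_antitone G A (Nat.le_add_right _ j) hx)
      ((h.mem_omegaSubgroup hG).1 (hle hx)).2 ha

theorem actionSeries_eq_bot (hG : IsPGroup p G) (h : IsPCentralAction p G A) {n : ℕ}
    (hexp : ∀ z ∈ actionSeries G A 1, z ^ p ^ n = 1) : actionSeries G A (p - 1 + n) = ⊥ := by
  refine eq_bot_iff.2 fun z hz => ?_
  have := h.actionSeries_le_omegaSubgroup hG (m := 0) (by simpa using hexp) hz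
  simpa using ((h.mem_omegaSubgroup hG).1 this).2

theorem isPGroup [Finite A] (hG : IsPGroup p G) (h : IsPCentralAction p G A)
    (hfaithful : ∀ a ∈ A, (∀ g ∈ G, Commute a g) → a = 1) : IsPGroup p A := by
  obtain ⟨n, hn⟩ := hG.exists_exponent_eq_pow
  have hbot := h.actionSeries_eq_bot hG (n := n) fun z hz => by
    have := Monoid.pow_exponent_eq_one (⟨z, actionSeries_le G A 1 hz⟩ : G)
    rw [hn] at this
    simpa [Subtype.ext_iff] using this
  intro a
  obtain ⟨k, m, hm, hk⟩ := Nat.exists_eq_pow_mul_and_not_dvd (orderOf_pos a).ne' p hp.out.ne_one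
  have hcop : (orderOf ((a : P) ^ p ^ k)).Coprime p := by
    rw [← coe_pow, orderOf_coe, orderOf_pow, hk, Nat.gcd_mul_right_left,
      Nat.mul_div_cancel_left _ (pow_pos hp.out.pos k)]
    exact ((hp.out.coprime_iff_not_dvd).2 hm).symm
  exact ⟨k, Subtype.ext (hfaithful _ (pow_mem a.2 _) fun g hg =>
    commute_of_coprime hG hbot (pow_mem a.2 _) hcop hg)⟩

theorem commute_pow_iff (hG : IsPGroup p G) (h : IsPCentralAction p G A) {a : P} (ha : a ∈ A)
    (hap : IsPGroup p (zpowers a)) (i : ℕ) {g : P} (hg : g ∈ G) :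
    Commute (a ^ p ^ i) g ↔ ⁅a, g⁆ ^ p ^ i = 1 := by
  have hmem : ⁅a, g⁆ ∈ actionSeries G A 1 := by
    refine commutator_actionSeries_le_succ G A 0 ?_
    rw [commutator_comm]
    exact commutator_mem_commutator ha hg
  rw [commutatorElement_eq_inv_inv_mul_conj] at hmem ⊢
  rw [← h.pow_prime_pow_eq_iff hG ha hap i
    (inv_mem (le_sup_left (b := actionSeries G A 1) (mem_zpowers a))) hmem, conj_pow,
    eq_mul_inv_iff_mul_eq, inv_pow]
  exact Commute.inv_left_iff.symm

end IsPCentralAction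

end PCentralAction

theorem finite_of_faithfulSMul (A G : Type*) [Group A] [MulAction A G] [FaithfulSMul A G]
    [Finite G] : Finite A :=
  .of_injective (MulAction.toPerm : A → Equiv.Perm G) MulAction.toPerm_injective

section ActionCommutators

variable {G : Type*} [Group G] {A : Type*} [Group A] [MulDistribMulAction A G]

theorem IsLeftNormedCommutator.mem_gammaAction {j k : ℕ} {c : G}
    (h : IsLeftNormedCommutator A j c) (hk : k ≤ j + 1) : c ∈ gammaAction k G A :=
  Subgroup.subset_closure ⟨j, hk, h⟩

theorem inv_mul_smul_mem_commutatorAction (x : G) (a : A) :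
    x⁻¹ * a • x ∈ commutatorAction G A :=
  Subgroup.subset_closure ⟨x, a, rfl⟩

instance gammaAction_normal (k : ℕ) : (gammaAction k G A).Normal := by
  refine ⟨fun x hx g => ?_⟩
  induction hx using Subgroup.closure_induction with
  | mem c hc =>
    obtain ⟨j, hj, h⟩ := hc
    simpa using mul_mem (h.mem_gammaAction hj) ((h.commGroup g⁻¹).mem_gammaAction hj)
  | one => simp
  | mul x y _ _ hx hy => simpa using mul_mem hx hy
  | inv x _ hx => simpa [mul_assoc] using inv_mem hx

theorem smul_mem_gammaAction {k : ℕ} {x : G} (hx : x ∈ gammaAction k G A) (a : A) :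
    a • x ∈ gammaAction k G A := by
  induction hx using Subgroup.closure_induction with
  | mem c hc =>
    obtain ⟨j, hj, h⟩ := hc
    simpa using mul_mem (h.mem_gammaAction hj)
      ((h.commAction a).mem_gammaAction (hj.trans (Nat.le_succ _)))
  | one => simp
  | mul x y _ _ hx hy => simpa using mul_mem hx hy
  | inv x _ hx => simpa using inv_mem hx

theorem inv_mul_smul_mem_gammaAction {k : ℕ} {x : G} (hx : x ∈ gammaAction k G A) (a : A) :
    x⁻¹ * a • x ∈ gammaAction (k + 1) G A := by
  have hnormal := gammaAction_normal (G := G) (A := A) (k + 1)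
  induction hx using Subgroup.closure_induction with
  | mem c hc =>
    obtain ⟨j, hj, h⟩ := hc
    exact (h.commAction a).mem_gammaAction (Nat.succ_le_succ hj)
  | one => simp
  | mul x y _ _ hx hy => simpa [mul_assoc] using mul_mem (hnormal.conj_mem _ hx y⁻¹) hy
  | inv x _ hx => simpa [mul_assoc] using hnormal.conj_mem _ (inv_mem hx) x

instance commutatorAction_normal : (commutatorAction G A).Normal := by
  refine ⟨fun x hx g => ?_⟩
  induction hx using Subgroup.closure_induction with
  | mem c hc =>
    obtain ⟨x, a, rfl⟩ := hc
    simpa [mul_assoc] using mul_mem (inv_mul_smul_mem_commutatorAction (x * g⁻¹) a)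
      (inv_mem (inv_mul_smul_mem_commutatorAction g⁻¹ a))
  | one => simp
  | mul x y _ _ hx hy => simpa using mul_mem hx hy
  | inv x _ hx => simpa [mul_assoc] using inv_mem hx

theorem smul_mem_commutatorAction {x : G} (hx : x ∈ commutatorAction G A) (a : A) :
    a • x ∈ commutatorAction G A := by
  simpa using mul_mem hx (inv_mul_smul_mem_commutatorAction x a)

end ActionCommutators

section Semidirect

open scoped commutatorElement
open SemidirectProduct Subgroup

variable {G : Type*} [Group G] {A : Type*} [Group A] [MulDistribMulAction A G]

local notation "Hol" => G ⋊[MulDistribMulAction.toMulAut A G] A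

theorem inl_smul (a : A) (g : G) : (inl (a • g) : Hol) = inr a * inl g * (inr a)⁻¹ := by
  rw [← map_inv, ← inl_aut]
  rfl

theorem commute_inr_inl_iff {a : A} {g : G} : Commute (inr a : Hol) (inl g) ↔ a • g = g := by
  rw [← inl_inj (φ := MulDistribMulAction.toMulAut A G), inl_smul, mul_inv_eq_iff_eq_mul]
  rfl

theorem commutatorElement_inl_inr (g : G) (a : A) :
    ⁅(inl g : Hol), (inr a : Hol)⁆ = inl (g⁻¹⁻¹ * a • g⁻¹) := by
  rw [map_mul, inl_smul, commutatorElement_eq_inv_inv_mul_conj, map_inv, map_inv]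

theorem normal_map_inl {N : Subgroup G} [hN : N.Normal] (h : ∀ x ∈ N, ∀ a : A, a • x ∈ N) :
    (N.map (inl : G →* Hol)).Normal := by
  refine ⟨?_⟩
  rintro _ ⟨x, hx, rfl⟩ y
  rw [← inl_left_mul_inr_right y]
  refine ⟨y.left * (y.right • x) * y.left⁻¹, hN.conj_mem _ (h x hx _) _, ?_⟩
  rw [map_mul, map_mul, inl_smul, map_inv]
  group

instance normal_range_inl : (inl : G →* Hol).range.Normal := by
  rw [range_inl_eq_ker_rightHom]
  infer_instance

instance finite_range_inl [Finite G] : Finite (inl : G →* Hol).range :=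
  .of_surjective _ (inl : G →* Hol).rangeRestrict_surjective

instance finite_range_inr [Finite A] : Finite (inr : A →* Hol).range :=
  .of_surjective _ (inr : A →* Hol).rangeRestrict_surjective

theorem actionSeries_le_map_gammaAction (k : ℕ) :
    actionSeries (inl : G →* Hol).range inr.range k ≤
      (gammaAction (k + 1) G A).map (inl : G →* Hol) := by
  induction k with
  | zero =>
    rintro _ ⟨g, rfl⟩
    exact mem_map_of_mem _ ((IsLeftNormedCommutator.base g).mem_gammaAction le_rfl)
  | succ k ih =>
    have := normal_map_inl fun x (hx : x ∈ gammaAction (k + 2) G A) => smul_mem_gammaAction hx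
    refine normalClosure_le_normal (commutator_le.2 fun x hx y hy => ?_)
    obtain ⟨g, hg, rfl⟩ := ih hx
    obtain ⟨a, rfl⟩ := hy
    rw [commutatorElement_inl_inr]
    exact mem_map_of_mem _ (inv_mul_smul_mem_gammaAction (inv_mem hg) a)

theorem actionSeries_one_eq_map_commutatorAction :
    actionSeries (inl : G →* Hol).range inr.range 1 =
      (commutatorAction G A).map (inl : G →* Hol) := by
  apply le_antisymm
  · have := normal_map_inl fun x (hx : x ∈ commutatorAction G A) => smul_mem_commutatorAction hx
    refine normalClosure_le_normal (commutator_le.2 ?_)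
    rintro _ ⟨g, rfl⟩ _ ⟨a, rfl⟩
    rw [commutatorElement_inl_inr]
    exact mem_map_of_mem _ (inv_mul_smul_mem_commutatorAction g⁻¹ a)
  · rw [map_le_iff_le_comap, commutatorAction, closure_le]
    rintro _ ⟨g, a, rfl⟩
    have := commutator_actionSeries_le_succ (inl : G →* Hol).range inr.range 0
      (commutator_mem_commutator (g₁ := inl g⁻¹) (g₂ := inr a) ⟨_, rfl⟩ ⟨_, rfl⟩)
    rw [commutatorElement_inl_inr] at this
    simpa using this

theorem inl_mem_actionSeries_one {x : G} :
    (inl x : Hol) ∈ actionSeries (inl : G →* Hol).range inr.range 1 ↔ x ∈ commutatorAction G A := by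
  rw [actionSeries_one_eq_map_commutatorAction, mem_map_iff_mem inl_injective]

theorem isPGroup_range_inl {p : ℕ} (hG : IsPGroup p G) : IsPGroup p (inl : G →* Hol).range :=
  hG.of_surjective _ (inl : G →* Hol).rangeRestrict_surjective

theorem ActsPCentrallyOn.isPCentralAction {p : ℕ} [hp : Fact p.Prime]
    (h : ActsPCentrallyOn p A (gammaAction p G A)) :
    IsPCentralAction p (inl : G →* Hol).range inr.range := by
  rintro z hz hzp _ ⟨a, rfl⟩
  obtain ⟨g, hg, rfl⟩ := actionSeries_le_map_gammaAction _ hz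
  rw [Nat.sub_add_cancel hp.out.one_le] at hg
  rw [← map_pow, ← map_one (inl : G →* Hol), inl_inj] at hzp
  exact commute_inr_inl_iff.2 (h g hg (orderOf_dvd_of_pow_eq_one hzp) a)

end Semidirect

namespace ActsPCentrallyOn

open scoped commutatorElement
open SemidirectProduct Subgroup

variable {p : ℕ} [hp : Fact p.Prime] {G : Type*} [Group G] [Finite G] {A : Type*} [Group A]
  [MulDistribMulAction A G]

local notation "Hol" => G ⋊[MulDistribMulAction.toMulAut A G] A

theorem inv_mul_pow_eq_one (h : ActsPCentrallyOn p A (gammaAction p G A)) (hG : IsPGroup p G)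
    {i : ℕ} {x y : G} (hx : x ∈ commutatorAction G A) (hy : y ∈ commutatorAction G A)
    (hxi : x ^ p ^ i = 1) (hyi : y ^ p ^ i = 1) : (x⁻¹ * y) ^ p ^ i = 1 := by
  have := h.isPCentralAction.inv_mul_pow_eq_one (isPGroup_range_inl hG) i
    (inl_mem_actionSeries_one.2 hx) (inl_mem_actionSeries_one.2 hy)
    (by rw [← map_pow, ← map_pow, hxi, hyi])
  rwa [← map_inv, ← map_mul, ← map_pow, ← map_one (inl : G →* Hol), inl_inj] at this

theorem coe_omegaSubgroup_commutatorAction (h : ActsPCentrallyOn p A (gammaAction p G A))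
    (hG : IsPGroup p G) (i : ℕ) :
    (omegaSubgroup (⊤ : Subgroup (commutatorAction G A)) (p ^ i) : Set (commutatorAction G A)) =
      {x | orderOf x ∣ p ^ i} :=
  coe_omegaSubgroup_top fun x y hx hy => by
    simp only [Subtype.ext_iff] at hx hy ⊢
    exact h.inv_mul_pow_eq_one hG x.2 y.2 hx hy

theorem actionSeries_eq_bot (h : ActsPCentrallyOn p A (gammaAction p G A)) (hG : IsPGroup p G)
    {n : ℕ} (hexp : ∀ x ∈ commutatorAction G A, x ^ p ^ n = 1) :
    actionSeries (inl : G →* Hol).range inr.range (n + p - 2 + 1) = ⊥ := by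
  have hp2 := hp.out.two_le
  rw [show n + p - 2 + 1 = p - 1 + n by lia]
  refine h.isPCentralAction.actionSeries_eq_bot (isPGroup_range_inl hG) ?_
  rw [actionSeries_one_eq_map_commutatorAction]
  rintro _ ⟨x, hx, rfl⟩
  rw [← map_pow, hexp x hx, map_one]

theorem lowerCentralSeries_commutatorAction_eq_bot
    (h : ActsPCentrallyOn p A (gammaAction p G A)) (hG : IsPGroup p G) {n : ℕ}
    (hexp : ∀ x ∈ commutatorAction G A, x ^ p ^ n = 1) :
    (⊤ : Subgroup (commutatorAction G A)).lowerCentralSeries (n + p - 2) = ⊥ := by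
  have hle := lowerCentralSeries_actionSeries_one_le (inl : G →* Hol).range inr.range (n + p - 2)
  rwa [h.actionSeries_eq_bot hG hexp, actionSeries_one_eq_map_commutatorAction,
    ← map_lowerCentralSeries, ← top_subtype_lowerCentralSeries, le_bot_iff,
    map_eq_bot_iff_of_injective _ inl_injective,
    map_eq_bot_iff_of_injective _ (subtype_injective _)] at hle

variable [FaithfulSMul A G]

theorem lowerCentralSeries_eq_bot (h : ActsPCentrallyOn p A (gammaAction p G A))
    (hG : IsPGroup p G) {n : ℕ} (hexp : ∀ x ∈ commutatorAction G A, x ^ p ^ n = 1) :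
    (⊤ : Subgroup A).lowerCentralSeries (n + p - 2) = ⊥ := by
  refine eq_bot_iff.2 fun a ha => eq_of_smul_eq_smul (α := G) fun g => ?_
  have hle := commutator_actionSeries_lowerCentralSeries_le (inl : G →* Hol).range inr.range 0
    (n + p - 2)
  rw [zero_add, h.actionSeries_eq_bot hG hexp, MonoidHom.range_eq_map, MonoidHom.range_eq_map,
    ← map_lowerCentralSeries] at hle
  have hone : ⁅(inl g : Hol), (inr a : Hol)⁆ = 1 :=
    hle (commutator_mem_commutator ⟨g, mem_top g, rfl⟩ (mem_map_of_mem inr ha))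
  rw [one_smul, ← commute_inr_inl_iff]
  exact (commutatorElement_eq_one_iff_commute.1 hone).symm

theorem isPGroup (h : ActsPCentrallyOn p A (gammaAction p G A)) (hG : IsPGroup p G) :
    IsPGroup p A := by
  have := finite_of_faithfulSMul A G
  have hrange : IsPGroup p (inr : A →* Hol).range := by
    refine h.isPCentralAction.isPGroup (isPGroup_range_inl hG) ?_
    rintro _ ⟨a, rfl⟩ ha
    have hone : a = 1 := eq_of_smul_eq_smul (α := G) fun g => by
      rw [one_smul, commute_inr_inl_iff.1 (ha _ ⟨g, rfl⟩)]
    rw [hone, map_one]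
  exact hrange.of_injective (inr : A →* Hol).rangeRestrict
    (MonoidHom.rangeRestrict_injective_iff.2 inr_injective)

theorem pow_smul_eq_self_iff (h : ActsPCentrallyOn p A (gammaAction p G A)) (hG : IsPGroup p G)
    (i : ℕ) {a : A} {g : G} : (a ^ p ^ i) • g = g ↔ (g⁻¹ * a • g) ^ p ^ i = 1 := by
  have hap : IsPGroup p (zpowers (inr a : Hol)) := by
    rw [← MonoidHom.map_zpowers]
    exact ((h.isPGroup hG).to_subgroup _).map inr
  have hcomm := h.isPCentralAction.commute_pow_iff (isPGroup_range_inl hG) ⟨a, rfl⟩ hap i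
    (g := inl g⁻¹) ⟨_, rfl⟩
  rw [← inv_inj (a := _ ^ _), ← inv_pow, commutatorElement_inv, commutatorElement_inl_inr, inv_one,
    ← map_pow, ← map_pow, ← map_one (inl : G →* Hol), inl_inj, inv_inv, map_inv,
    Commute.inv_right_iff, commute_inr_inl_iff] at hcomm
  rwa [inv_inv] at hcomm

theorem pow_eq_one_iff_forall_smul (h : ActsPCentrallyOn p A (gammaAction p G A))
    (hG : IsPGroup p G) (i : ℕ) {a : A} : a ^ p ^ i = 1 ↔ ∀ g : G, (g⁻¹ * a • g) ^ p ^ i = 1 := by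
  simp only [← h.pow_smul_eq_self_iff hG i]
  refine ⟨fun ha g => by rw [ha, one_smul], fun ha => eq_of_smul_eq_smul (α := G) fun g => ?_⟩
  rw [ha, one_smul]

theorem coe_omegaSubgroup (h : ActsPCentrallyOn p A (gammaAction p G A)) (hG : IsPGroup p G)
    (i : ℕ) : (omegaSubgroup (⊤ : Subgroup A) (p ^ i) : Set A) = {a | orderOf a ∣ p ^ i} :=
  coe_omegaSubgroup_top fun a b ha hb => by
    rw [← inv_eq_one, ← inv_pow, h.pow_eq_one_iff_forall_smul hG] at ha
    rw [h.pow_eq_one_iff_forall_smul hG] at hb ⊢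
    intro g
    have hmul : g⁻¹ * (a⁻¹ * b) • g = (g⁻¹ * a⁻¹ • g)⁻¹⁻¹ * a⁻¹ • (g⁻¹ * b • g) := by
      simp [mul_smul]
    rw [hmul]
    refine h.inv_mul_pow_eq_one hG (inv_mem (inv_mul_smul_mem_commutatorAction g a⁻¹))
      (smul_mem_commutatorAction (inv_mul_smul_mem_commutatorAction g b) a⁻¹) ?_ ?_
    · rw [inv_pow, ha g, inv_one]
    · rw [← smul_pow', hb g, smul_one]

theorem forall_pow_eq_one_iff (h : ActsPCentrallyOn p A (gammaAction p G A)) (hG : IsPGroup p G)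
    (i : ℕ) : (∀ x ∈ commutatorAction G A, x ^ p ^ i = 1) ↔ ∀ a : A, a ^ p ^ i = 1 := by
  refine ⟨fun hN a => (h.pow_eq_one_iff_forall_smul hG i).2 fun g =>
    hN _ (inv_mul_smul_mem_commutatorAction g a), fun hA x hx => ?_⟩
  have hle : commutatorAction G A ≤ omegaSubgroup (commutatorAction G A) (p ^ i) := by
    conv_lhs => rw [commutatorAction]
    refine (closure_le _).2 ?_
    rintro _ ⟨g, a, rfl⟩
    exact subset_closure ⟨inv_mul_smul_mem_commutatorAction g a,
      (h.pow_eq_one_iff_forall_smul hG i).1 (hA a) g⟩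
  exact ((mem_omegaSubgroup_iff fun x hx y hy => h.inv_mul_pow_eq_one hG hx hy).1 (hle hx)).2

theorem exponent_commutatorAction_eq (h : ActsPCentrallyOn p A (gammaAction p G A))
    (hG : IsPGroup p G) : Monoid.exponent (commutatorAction G A) = Monoid.exponent A := by
  have := finite_of_faithfulSMul A G
  have hiff (i : ℕ) :
      Monoid.exponent (commutatorAction G A) ∣ p ^ i ↔ Monoid.exponent A ∣ p ^ i := by
    simp only [Monoid.exponent_dvd_iff_forall_pow_eq_one, ← h.forall_pow_eq_one_iff hG i,
      Subtype.forall, Subtype.ext_iff, coe_pow, coe_one]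
  obtain ⟨m, hm⟩ := (hG.to_subgroup (commutatorAction G A)).exists_exponent_eq_pow
  obtain ⟨n, hn⟩ := (h.isPGroup hG).exists_exponent_eq_pow
  exact Nat.dvd_antisymm (hn ▸ (hiff n).2 hn.dvd) (hm ▸ (hiff m).1 hm.dvd)

end ActsPCentrallyOn

theorem mainTheorem1_general (p : ℕ) [Fact p.Prime] (G : Type*) [Group G] [Finite G]
    (hG : IsPGroup p G) (A : Type*) [Group A] [MulDistribMulAction A G] [FaithfulSMul A G]
    (hA : ActsPCentrallyOn p A (gammaAction p G A)) :
    (∀ i : ℕ, 1 ≤ i →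
      ∃ K : Subgroup (commutatorAction G A),
        (K : Set (commutatorAction G A)) = {x | orderOf x ∣ p ^ i}) ∧
    (∀ i : ℕ, 1 ≤ i → ∃ B : Subgroup A, (B : Set A) = {a | orderOf a ∣ p ^ i}) ∧
    Monoid.exponent (commutatorAction G A) = Monoid.exponent A ∧
    ∃ n : ℕ, Monoid.exponent A = p ^ n ∧
      Group.IsNilpotent A ∧ Group.nilpotencyClass A ≤ n + p - 2 ∧
      Group.IsNilpotent (commutatorAction G A) ∧
      Group.nilpotencyClass (commutatorAction G A) ≤ n + p - 2 := by
  have := finite_of_faithfulSMul A G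
  have hAp : IsPGroup p A := hA.isPGroup hG
  have hnilA : Group.IsNilpotent A := hAp.isNilpotent
  have hnilN : Group.IsNilpotent (commutatorAction G A) := (hG.to_subgroup _).isNilpotent
  obtain ⟨n, hn⟩ := hAp.exists_exponent_eq_pow
  have hexp : ∀ x ∈ commutatorAction G A, x ^ p ^ n = 1 :=
    (hA.forall_pow_eq_one_iff hG n).2 (Monoid.exponent_dvd_iff_forall_pow_eq_one.1 hn.dvd)
  exact ⟨fun i _ => ⟨_, hA.coe_omegaSubgroup_commutatorAction hG i⟩,
    fun i _ => ⟨_, hA.coe_omegaSubgroup hG i⟩,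
    hA.exponent_commutatorAction_eq hG,
    n, hn,
    hnilA, Subgroup.lowerCentralSeries_eq_bot_iff_nilpotencyClass_le.1
      (hA.lowerCentralSeries_eq_bot hG hexp),
    hnilN, Subgroup.lowerCentralSeries_eq_bot_iff_nilpotencyClass_le.1
      (hA.lowerCentralSeries_commutatorAction_eq_bot hG hexp)⟩

theorem mainTheorem1 (p : ℕ) [Fact p.Prime] (G : Type*) [Group G] [Finite G] (hG : IsPGroup p G)
    (A : Subgroup (MulAut G)) (hA : ActsPCentrallyOn p A (gammaAction p G A)) :
    (∀ i : ℕ, 1 ≤ i →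
      ∃ K : Subgroup (commutatorAction G A),
        (K : Set (commutatorAction G A)) = {x | orderOf x ∣ p ^ i}) ∧
    (∀ i : ℕ, 1 ≤ i → ∃ B : Subgroup A, (B : Set A) = {a | orderOf a ∣ p ^ i}) ∧
    Monoid.exponent (commutatorAction G A) = Monoid.exponent A ∧
    ∃ n : ℕ, Monoid.exponent A = p ^ n ∧
      Group.IsNilpotent A ∧ Group.nilpotencyClass A ≤ n + p - 2 ∧
      Group.IsNilpotent (commutatorAction G A) ∧
      Group.nilpotencyClass (commutatorAction G A) ≤ n + p - 2 :=
  mainTheorem1_general p G hG A hA
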